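/- Consider unconstrained online linear optimization in $\mathbb{R}^d$, $d\ge 1$, with the Euclidean norm: in each round $t=1,2,\dots$ a deterministic algorithm predicts $x_t\in\mathbb{R}^d$ as a function of $g_1,\dots,g_{t-1}$, and then an adversary chooses a loss gradient $g_t\in\mathbb{R}^d$ with $\|g_t\|\le 1$ as a function of $x_1,\dots,x_t$. For $u\in\mathbb{R}^d$ and $T\ge 1$ the regret is $\mathrm{Regret}_T(u)=\sum_{t=1}^T\langle g_t,x_t\rangle-\sum_{t=1}^T\langle g_t,u\rangle$. **Theorem.** For all $C>0$, $\eta\in(0,1)$ and $U\ge 12\eta^{-1}C$ there exists a positive integer $T_0$, depending only on $\eta$, $U$ and $C$, such that the following holds. For every $d\ge1$, every $T\ge T_0$ and every algorithm in $\mathbb{R}^d$ that guarantees $\mathrm{Regret}_T(0)\le C\sqrt{e}$ against all adversaries, there exist an adversary and a comparator $u\in\mathbb{R}^d$ with $\|u\|=U$ such that, in the game between this algorithm and this adversary, $$\mathrm{Regret}_T(u)\;\ge\;\Bigl[1-\frac{\eta}{\log T}\Bigr]\,\|u\|\,\sqrt{2T\log\frac{\eta\|u\|\sqrt{T}}{2\sqrt{\pi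 e}\,C\log T}}.$$ -/

import Mathlib

namespace OLO

/-- The domain `ℝ^d` with the Euclidean norm. -/
abbrev Point (d : ℕ) : Type := EuclideanSpace ℝ (Fin d)

/-- The loss gradients available to the adversary: the closed Euclidean unit ball of `ℝ^d`. -/
abbrev Grad (d : ℕ) : Type := Metric.closedBall (0 : Point d) 1

/-- A deterministic unconstrained OLO algorithm. Rounds are indexed from `0`: in round `t` it
predicts a point as a function of the `t` gradients revealed in the earlier rounds. -/
abbrev Algorithm (d : ℕ) : Type := (t : ℕ) → (Fin t → Grad d) → Point d

/-- An adaptive adversary: in round `t` (from `0`) it chooses a gradient in the unit ball as a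
function of the `t + 1` predictions made so far, the current one included. -/
abbrev Adversary (d : ℕ) : Type := (t : ℕ) → (Fin (t + 1) → Point d) → Grad d

/-- The predictions and the gradients of the first `t` rounds of the game. -/
noncomputable def history {d : ℕ} (A : Algorithm d) (adv : Adversary d) :
    (t : ℕ) → (Fin t → Point d) × (Fin t → Grad d)
  | 0 => (Fin.elim0, Fin.elim0)
  | t + 1 =>
    let h := history A adv t
    let xs : Fin (t + 1) → Point d := Fin.snoc h.1 (A t h.2)
    (xs, Fin.snoc h.2 (adv t xs))

/-- The prediction of the algorithm in round `t` (from `0`). -/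
noncomputable def prediction {d : ℕ} (A : Algorithm d) (adv : Adversary d) (t : ℕ) : Point d :=
  (history A adv (t + 1)).1 (Fin.last t)

/-- The gradient chosen by the adversary in round `t` (from `0`). -/
noncomputable def gradient {d : ℕ} (A : Algorithm d) (adv : Adversary d) (t : ℕ) : Grad d :=
  (history A adv (t + 1)).2 (Fin.last t)

theorem history_eq {d : ℕ} (A : Algorithm d) (adv : Adversary d) (t : ℕ) :
    history A adv t = (fun i : Fin t => prediction A adv i, fun i : Fin t => gradient A adv i) := by
  induction t with
  | zero => ext i <;> exact i.elim0
  | succ t ih =>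
    refine Prod.ext (funext fun i => ?_) (funext fun i => ?_) <;>
    · refine Fin.lastCases ?_ (fun j => ?_) i
      · rfl
      · simp only [history, Fin.snoc_castSucc]
        rw [ih]
        rfl

/-- The predictions obey the algorithm. -/
theorem prediction_eq {d : ℕ} (A : Algorithm d) (adv : Adversary d) (t : ℕ) :
    prediction A adv t = A t (fun i : Fin t => gradient A adv i) := by
  have h : prediction A adv t = A t (history A adv t).2 := by
    simp [prediction, history]
  rw [h, history_eq]

/-- The gradients obey the adversary. -/
theorem gradient_eq {d : ℕ} (A : Algorithm d) (adv : Adversary d) (t : ℕ) :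
    gradient A adv t = adv t (fun i : Fin (t + 1) => prediction A adv i) := by
  have h : gradient A adv t = adv t (history A adv (t + 1)).1 := by
    simp [gradient, history]
  rw [h, history_eq]

/-- The regret `∑ ⟨g_t, x_t⟩ - ∑ ⟨g_t, u⟩` over the first `T` rounds of the game between `A` and
`adv`, with respect to the comparator `u`. -/
noncomputable def regret {d : ℕ} (A : Algorithm d) (adv : Adversary d) (T : ℕ) (u : Point d) : ℝ :=
  ∑ t ∈ Finset.range T, inner ℝ (gradient A adv t : Point d) (prediction A adv t)
    - ∑ t ∈ Finset.range T, inner ℝ (gradient A adv t : Point d) u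

end OLO

/-! Random signs on a fixed unit vector give any algorithm expected loss zero, while the better of
the comparators `±U • e` gains `U |S|`, with `S` the final position of a simple random walk. If
every sign pattern kept the regret below `R`, the loss would be at most `ε - max (U |S| - R) 0` on
each pattern, with `ε = C √e` the regret allowed against `0`; averaging forces `E max (U |S| - R) 0
≤ ε` (`OLO.exists_regret_ge`). It remains to make this expected excess larger than `ε`. Only two
symmetric windows just beyond the threshold are kept (`two_mul_sq_mul_choose_le_sum`), with the
binomial coefficient at their far edge bounded below by `centralBinom_mul_exp_le_choose`. A window
of length about `√(T / log T)` costs only a constant factor in that coefficient. The excess then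
tends to a constant exceeding `C √e` (`eventually_lt_excess`). -/

/-! ### Binomial coefficients and tails. -/

theorem exp_neg_add_sq_le_one_sub {y : ℝ} (h0 : 0 ≤ y) (h1 : y ≤ 1 / 2) :
    Real.exp (-(y + y ^ 2)) ≤ 1 - y := by
  have hq := Real.quadratic_le_exp_of_nonneg (x := y + y ^ 2) (by positivity)
  rw [Real.exp_neg, inv_le_comm₀ (Real.exp_pos _) (by linarith)]
  refine le_trans ?_ hq
  rw [inv_le_iff_one_le_mul₀ (by linarith)]
  nlinarith [mul_nonneg (sq_nonneg y) (sub_nonneg.2 h1), sq_nonneg y, mul_nonneg h0 (sq_nonneg y),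
    mul_nonneg (mul_nonneg h0 (sq_nonneg y)) (sub_nonneg.2 h1),
    mul_nonneg (mul_nonneg (sq_nonneg y) (sq_nonneg y)) (sub_nonneg.2 h1),
    mul_nonneg (sq_nonneg y) (sq_nonneg y)]

theorem four_pow_le_two_sqrt_mul_centralBinom {n : ℕ} (hn : 1 ≤ n) :
    (4 : ℝ) ^ n ≤ 2 * √n * n.centralBinom := by
  induction n, hn using Nat.le_induction with
  | base => norm_num [Nat.centralBinom, Nat.choose]
  | succ n hn ih =>
    have hrec : ((n : ℝ) + 1) * (n + 1).centralBinom = 2 * (2 * n + 1) * n.centralBinom := by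
      exact_mod_cast Nat.succ_mul_centralBinom_succ n
    have hn0 : (0 : ℝ) < n := by exact_mod_cast hn
    -- AM-GM on `n` and `n + 1`; this absorbs the ratio of successive central binomials.
    have hs : 2 * √n * √((n : ℝ) + 1) ≤ 2 * n + 1 := by
      nlinarith [sq_nonneg (√n - √((n : ℝ) + 1)), Real.sq_sqrt hn0.le,
        Real.sq_sqrt (show (0 : ℝ) ≤ n + 1 by positivity)]
    have hs1 : √((n : ℝ) + 1) * √((n : ℝ) + 1) = n + 1 := Real.mul_self_sqrt (by positivity)
    have hpos : 0 < √((n : ℝ) + 1) := Real.sqrt_pos.2 (by positivity)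
    push_cast
    refine le_of_mul_le_mul_left ?_ hpos
    calc √((n : ℝ) + 1) * 4 ^ (n + 1) = 4 * √((n : ℝ) + 1) * 4 ^ n := by ring
      _ ≤ 4 * √((n : ℝ) + 1) * (2 * √n * n.centralBinom) := by gcongr
      _ = 4 * (2 * √n * √((n : ℝ) + 1)) * n.centralBinom := by ring
      _ ≤ 4 * (2 * n + 1) * n.centralBinom := by gcongr
      _ = 2 * (((n : ℝ) + 1) * (n + 1).centralBinom) := by rw [hrec]; ring
      _ = √((n : ℝ) + 1) * (2 * √((n : ℝ) + 1) * (n + 1).centralBinom) := by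
        linear_combination (-2 * ((n + 1).centralBinom : ℝ)) * hs1

/-- A moderate-deviation lower bound for the binomial coefficients near the centre. -/
theorem centralBinom_mul_exp_le_choose {n : ℕ} (hn : 1 ≤ n) (m : ℕ) (hm : 4 * m ≤ n) :
    n.centralBinom * Real.exp (-((m : ℝ) ^ 2 / n + 4 * (m : ℝ) ^ 3 / (n : ℝ) ^ 2)) ≤
      ((2 * n).choose (n + m) : ℝ) := by
  have hn0 : (0 : ℝ) < n := by exact_mod_cast hn
  induction m with
  | zero => simp [Nat.centralBinom]
  | succ m ih =>
    have hm' : (4 : ℝ) * (m + 1) ≤ n := by exact_mod_cast hm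
    have hm0 : (0 : ℝ) ≤ m := m.cast_nonneg
    -- Consecutive coefficients have ratio `(n - m) / (n + m + 1) ≥ 1 - y`. Summing `y` over the
    -- steps gives `m ^ 2 / n`, and the cubic term pays for the sum of `y ^ 2`.
    set y : ℝ := (2 * m + 1) / n with hy
    have hy0 : 0 ≤ y := by positivity
    have hy1 : y ≤ 1 / 2 := by rw [hy, div_le_iff₀ hn0]; linarith
    have hrec : ((2 * n).choose (n + (m + 1)) : ℝ) * (n + m + 1) =
        (2 * n).choose (n + m) * (n - m) := by
      have h := Nat.choose_succ_right_eq (2 * n) (n + m)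
      have h2 : 2 * n - (n + m) = n - m := by omega
      rw [h2] at h
      have h3 : ((n - m : ℕ) : ℝ) = n - m := by rw [Nat.cast_sub (by omega)]
      rw [← h3]
      exact_mod_cast h
    have hstep : (1 - y) * (n + m + 1) ≤ n - m := by
      have : y * n = 2 * m + 1 := by rw [hy]; field_simp
      nlinarith
    have hexp : Real.exp (-(((m + 1 : ℕ) : ℝ) ^ 2 / n + 4 * ((m + 1 : ℕ) : ℝ) ^ 3 / (n : ℝ) ^ 2)) ≤
        Real.exp (-((m : ℝ) ^ 2 / n + 4 * (m : ℝ) ^ 3 / (n : ℝ) ^ 2)) * (1 - y) := by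
      refine le_trans ?_ (mul_le_mul_of_nonneg_left (exp_neg_add_sq_le_one_sub hy0 hy1)
        (Real.exp_pos _).le)
      rw [← Real.exp_add, Real.exp_le_exp]
      have : ((m + 1 : ℕ) : ℝ) ^ 2 / n + 4 * ((m + 1 : ℕ) : ℝ) ^ 3 / (n : ℝ) ^ 2 =
          (m : ℝ) ^ 2 / n + 4 * (m : ℝ) ^ 3 / (n : ℝ) ^ 2 + (y + y ^ 2) +
            (8 * m ^ 2 + 8 * m + 3) / (n : ℝ) ^ 2 := by
        rw [hy]; push_cast; field_simp; ring
      rw [this]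
      have : (0 : ℝ) ≤ (8 * m ^ 2 + 8 * m + 3) / (n : ℝ) ^ 2 := by positivity
      linarith
    have hpos : (0 : ℝ) < n + m + 1 := by positivity
    refine le_of_mul_le_mul_right ?_ hpos
    rw [hrec]
    calc _ ≤ (n.centralBinom : ℝ) *
          (Real.exp (-((m : ℝ) ^ 2 / n + 4 * (m : ℝ) ^ 3 / (n : ℝ) ^ 2)) * (1 - y)) *
            (n + m + 1) := by gcongr
      _ = (n.centralBinom * Real.exp (-((m : ℝ) ^ 2 / n + 4 * (m : ℝ) ^ 3 / (n : ℝ) ^ 2))) *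
          ((1 - y) * (n + m + 1)) := by ring
      _ ≤ _ := mul_le_mul (ih (by omega)) hstep
          (mul_nonneg (by linarith) hpos.le) (Nat.cast_nonneg _)

/-- The two tails of the binomial expansion dominate the triangular sum over a window of length
`N` on each side. -/
theorem two_mul_sq_mul_choose_le_sum {n K N : ℕ} (hKN : K + N ≤ n) {U R : ℝ} (hU : 0 ≤ U)
    (hR : R ≤ U * (2 * K)) :
    2 * U * (N : ℝ) ^ 2 * (2 * n).choose (n + (K + N)) ≤
      ∑ k ∈ Finset.range (2 * n + 1),
        ((2 * n).choose k : ℝ) * max (U * |2 * (k : ℝ) - 2 * n| - R) 0 := by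
  set c := (((2 * n).choose (n + (K + N)) : ℕ) : ℝ) with hc
  set f : ℕ → ℝ := fun k => ((2 * n).choose k : ℝ) * max (U * |2 * (k : ℝ) - 2 * n| - R) 0 with hf
  have hf0 : ∀ k, 0 ≤ f k := fun k => by positivity
  -- Coefficients decrease away from the centre, so the far edge is the smallest in the window.
  have hmono : ∀ j < N, c ≤ (2 * n).choose (n + (K + 1 + j)) := by
    intro j hj
    have hdec : ∀ i, K + 1 + j + i ≤ n →
        (2 * n).choose (n + (K + 1 + j + i)) ≤ (2 * n).choose (n + (K + 1 + j)) := by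
      intro i
      induction i with
      | zero => intro; simp
      | succ i ih =>
        intro h
        refine le_trans ?_ (ih (by omega))
        have h1 := Nat.choose_succ_right_eq (2 * n) (n + (K + 1 + j + i))
        have h2 : 2 * n - (n + (K + 1 + j + i)) ≤ n + (K + 1 + j + i) + 1 := by omega
        have h3 := Nat.mul_le_mul_left ((2 * n).choose (n + (K + 1 + j + i))) h2
        rw [← h1] at h3
        exact Nat.le_of_mul_le_mul_right h3 (by omega)
    have := hdec (N - 1 - j) (by omega)
    rw [show K + 1 + j + (N - 1 - j) = K + N by omega] at this
    rw [hc]; exact_mod_cast this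
  have hup : ∀ j < N, U * (2 * (j + 1)) * c ≤ f (n + (K + 1 + j)) := by
    intro j hj
    have h1 : |2 * ((n + (K + 1 + j) : ℕ) : ℝ) - 2 * n| = 2 * (K + 1 + j) := by
      rw [abs_of_nonneg] <;> push_cast <;> [ring; skip]
      have : (0 : ℝ) ≤ 2 * (K + 1 + j) := by positivity
      linarith
    simp only [hf, h1]
    rw [mul_comm]
    refine mul_le_mul (hmono j hj) (le_max_of_le_left ?_) (by positivity) (by positivity)
    linarith
  have hdown : ∀ j < N, f (n - (K + 1 + j)) = f (n + (K + 1 + j)) := by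
    intro j hj
    have h1 : (2 * n).choose (n - (K + 1 + j)) = (2 * n).choose (n + (K + 1 + j)) :=
      Nat.choose_symm_of_eq_add (by omega)
    simp only [hf, h1]
    rw [Nat.cast_sub (by omega), abs_sub_comm]
    push_cast
    congr 5
    ring
  have htri : ∑ j ∈ Finset.range N, (2 * ((j : ℝ) + 1)) = N * (N + 1) := by
    clear * -
    induction N with
    | zero => simp
    | succ N ih => rw [Finset.sum_range_succ, ih]; push_cast; ring
  have hwin : U * (N : ℝ) ^ 2 * c ≤ ∑ j ∈ Finset.range N, f (n + (K + 1 + j)) := by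
    calc U * (N : ℝ) ^ 2 * c ≤ U * (N * (N + 1)) * c := by
          have : (0 : ℝ) ≤ N := N.cast_nonneg
          gcongr
          nlinarith
      _ = ∑ j ∈ Finset.range N, U * (2 * ((j : ℝ) + 1)) * c := by
          rw [← htri, Finset.mul_sum, Finset.sum_mul]
      _ ≤ _ := Finset.sum_le_sum fun j hj => hup j (Finset.mem_range.1 hj)
  have hdisj : Disjoint ((Finset.range N).image fun j => n + (K + 1 + j))
      ((Finset.range N).image fun j => n - (K + 1 + j)) := by
    rw [Finset.disjoint_left]
    simp only [Finset.mem_image, Finset.mem_range]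
    rintro _ ⟨i, hi, rfl⟩ ⟨j, hj, h⟩
    omega
  have hsub : ((Finset.range N).image fun j => n + (K + 1 + j)) ∪
      ((Finset.range N).image fun j => n - (K + 1 + j)) ⊆ Finset.range (2 * n + 1) := by
    intro k
    simp only [Finset.mem_union, Finset.mem_image, Finset.mem_range]
    rintro (⟨i, hi, rfl⟩ | ⟨i, hi, rfl⟩) <;> omega
  refine le_trans ?_ (Finset.sum_le_sum_of_subset_of_nonneg hsub fun k _ _ => hf0 k)
  rw [Finset.sum_union hdisj, Finset.sum_image (by intro i _ j _ h; simp at h; omega),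
    Finset.sum_image (by
      intro i hi j hj h
      simp only [Finset.coe_range, Set.mem_Iio] at hi hj
      simp only at h
      omega),
    Finset.sum_congr rfl fun j hj => hdown j (Finset.mem_range.1 hj)]
  linarith

/-! ### The random-sign adversary. -/

namespace OLO

variable {d : ℕ}

/-- The gradient of round `t` that is `e` on `σ`, `-e` on the other rounds before `m`, and `0` from
round `m` on. -/
noncomputable def signGradient (e : Point d) (he : ‖e‖ = 1) (m : ℕ) (σ : Finset ℕ) (t : ℕ) :
    Grad d :=
  ⟨if t < m then (if t ∈ σ then e else -e) else 0, by
    rw [mem_closedBall_zero_iff]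
    split_ifs <;> simp [he]⟩

/-- The oblivious adversary that plays `signGradient`. -/
noncomputable def signAdversary (e : Point d) (he : ‖e‖ = 1) (m : ℕ) (σ : Finset ℕ) :
    Adversary d :=
  fun t _ => signGradient e he m σ t

theorem gradient_signAdversary (A : Algorithm d) (e : Point d) (he : ‖e‖ = 1) (m : ℕ)
    (σ : Finset ℕ) (t : ℕ) :
    gradient A (signAdversary e he m σ) t = signGradient e he m σ t := by
  rw [gradient_eq]; rfl

/-- Averaged over all sign patterns, the loss of every round vanishes. -/
theorem sum_powerset_inner_signGradient (A : Algorithm d) (e : Point d) (he : ‖e‖ = 1) (m t : ℕ) :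
    ∑ σ ∈ (Finset.range m).powerset,
      inner ℝ (gradient A (signAdversary e he m σ) t : Point d)
        (prediction A (signAdversary e he m σ) t) = 0 := by
  simp only [prediction_eq, gradient_signAdversary]
  by_cases ht : t < m
  -- Flipping sign `t` negates the gradient of round `t` but leaves its prediction alone, which sees
  -- only earlier rounds. The patterns thus cancel in pairs.
  · have hne : ∀ σ : Finset ℕ, ∀ i : Fin t,
        signGradient e he m (symmDiff σ {t}) i = signGradient e he m σ i := by
      intro σ i
      have : (i : ℕ) ≠ t := i.2.ne
      simp [signGradient, Finset.mem_symmDiff, this]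
    have hflip : ∀ σ : Finset ℕ, (signGradient e he m (symmDiff σ {t}) t : Point d) =
        -(signGradient e he m σ t : Point d) := by
      intro σ
      by_cases h : t ∈ σ <;> simp [signGradient, Finset.mem_symmDiff, ht, h]
    refine Finset.sum_involution (fun σ _ => symmDiff σ {t}) ?_ ?_ ?_ ?_
    · intro σ _
      simp only [hne, hflip, inner_neg_left, add_neg_cancel]
    · intro σ _ _ h
      have := congrArg (t ∈ ·) h
      simp [Finset.mem_symmDiff] at this
    · intro σ hσ
      rw [Finset.mem_powerset] at hσ ⊢
      intro i hi
      rcases Finset.mem_symmDiff.1 hi with h | h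
      · exact hσ h.1
      · rw [Finset.mem_singleton.1 h.1]; exact Finset.mem_range.2 ht
    · intro σ _
      simp
  · simp [signGradient, ht]

theorem sum_inner_signGradient (e : Point d) (he : ‖e‖ = 1) {m T : ℕ} (hm : m ≤ T)
    {σ : Finset ℕ} (hσ : σ ⊆ Finset.range m) (c : ℝ) :
    ∑ t ∈ Finset.range T, inner ℝ (signGradient e he m σ t : Point d) (c • e) =
      c * (2 * (σ.card : ℝ) - m) := by
  have hterm : ∀ t, inner ℝ (signGradient e he m σ t : Point d) (c • e) =
      c * ((if t ∈ σ then 2 else 0) - (if t < m then 1 else 0)) := by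
    intro t
    have hlt : t ∈ σ → t < m := fun h => Finset.mem_range.1 (hσ h)
    by_cases h1 : t ∈ σ
    · simp [signGradient, h1, hlt h1, inner_smul_right, he]; ring
    · by_cases h2 : t < m <;> simp [signGradient, h1, h2, inner_smul_right, he]
  have h1 : (Finset.range T).filter (· ∈ σ) = σ := by
    ext t
    simp only [Finset.mem_filter, Finset.mem_range, and_iff_right_iff_imp]
    exact fun h => (Finset.mem_range.1 (hσ h)).trans_le hm
  have h2 : (Finset.range T).filter (· < m) = Finset.range m := by
    ext t
    simp only [Finset.mem_filter, Finset.mem_range, and_iff_right_iff_imp]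
    exact fun h => h.trans_le hm
  simp only [hterm]
  rw [← Finset.mul_sum, Finset.sum_sub_distrib, ← Finset.sum_filter, ← Finset.sum_filter, h1, h2]
  simp [mul_comm]

/-- If the expected excess of `U |S|` over `R`, for a random walk `S` of `m` steps, is larger than
the regret that the algorithm guarantees against `0`, then some sign pattern forces regret `R`. -/
theorem exists_regret_ge (hd : 0 < d) (A : Algorithm d) {m T : ℕ} (hm : m ≤ T) {U R ε : ℝ}
    (hU : 0 ≤ U) (hε : 0 ≤ ε) (hA : ∀ adv : Adversary d, regret A adv T 0 ≤ ε)
    (hexc : 2 ^ m * ε < ∑ k ∈ Finset.range (m + 1),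
      (m.choose k : ℝ) * max (U * |2 * (k : ℝ) - m| - R) 0) :
    ∃ (adv : Adversary d) (u : Point d), ‖u‖ = U ∧ R ≤ regret A adv T u := by
  by_contra! hcon
  set e : Point d := EuclideanSpace.single ⟨0, hd⟩ 1
  have he : ‖e‖ = 1 := by simp [e]
  set V : Finset ℕ → ℝ := fun σ => ∑ t ∈ Finset.range T,
    inner ℝ (gradient A (signAdversary e he m σ) t : Point d)
      (prediction A (signAdversary e he m σ) t) with hV
  have hV0 : ∑ σ ∈ (Finset.range m).powerset, V σ = 0 := by
    rw [hV, Finset.sum_comm]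
    exact Finset.sum_eq_zero fun t _ => sum_powerset_inner_signGradient A e he m t
  have hVle : ∀ σ ∈ (Finset.range m).powerset,
      V σ ≤ ε - max (U * |2 * (σ.card : ℝ) - m| - R) 0 := by
    intro σ hσ
    have h0 := hA (signAdversary e he m σ)
    simp only [regret, inner_zero_right, Finset.sum_const_zero, sub_zero] at h0
    have hc : ∀ c : ℝ, |c| = U → V σ - c * (2 * (σ.card : ℝ) - m) < R := by
      intro c hc
      have h := hcon (signAdversary e he m σ) (c • e) (by rw [norm_smul, he, mul_one]; exact hc)
      rw [regret] at h
      simp only [gradient_signAdversary] at h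
      rw [sum_inner_signGradient e he hm (Finset.mem_powerset.1 hσ)] at h
      simpa only [hV, gradient_signAdversary] using h
    -- The comparator points against the sum of the gradients.
    have habs : V σ + U * |2 * (σ.card : ℝ) - m| < R := by
      rcases abs_cases (2 * (σ.card : ℝ) - m) with h | h <;> rw [h.1]
      · have := hc (-U) (by rw [abs_neg, abs_of_nonneg hU]); linarith
      · have := hc U (abs_of_nonneg hU); linarith
    have h0' : V σ ≤ ε := h0
    rcases max_cases (U * |2 * (σ.card : ℝ) - m| - R) 0 with h | h <;> linarith
  have hsum := Finset.sum_le_sum hVle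
  have hcard := Finset.sum_powerset_apply_card
    (fun k => max (U * |2 * (k : ℝ) - m| - R) 0) (x := Finset.range m)
  rw [hV0, Finset.sum_sub_distrib, hcard] at hsum
  simp only [Finset.card_range, nsmul_eq_mul, Finset.sum_const, Finset.card_powerset] at hsum
  push_cast at hsum
  linarith

end OLO

/-! ### Asymptotics of the window and of the excess. -/

open Filter Topology

theorem tendsto_log_natCast_atTop : Tendsto (fun T : ℕ => Real.log T) atTop atTop :=
  Real.tendsto_log_atTop.comp tendsto_natCast_atTop_atTop

theorem tendsto_log_natCast_pow_div (k : ℕ) :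
    Tendsto (fun T : ℕ => Real.log T ^ k / T) atTop (𝓝 0) :=
  ((Real.isLittleO_pow_log_id_atTop (n := k)).tendsto_div_nhds_zero).comp
    tendsto_natCast_atTop_atTop

theorem tendsto_sqrt_log_natCast_div_sqrt :
    Tendsto (fun T : ℕ => √(Real.log T) / √T) atTop (𝓝 0) := by
  have h := (Real.continuous_sqrt.tendsto 0).comp (tendsto_log_natCast_pow_div 1)
  rw [Real.sqrt_zero] at h
  refine h.congr fun T => ?_
  simp only [Function.comp, pow_one]
  rw [Real.sqrt_div' _ (Nat.cast_nonneg T)]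

theorem tendsto_sqrt_log_natCast_pow_three_div_sqrt :
    Tendsto (fun T : ℕ => √(Real.log T) ^ 3 / √T) atTop (𝓝 0) := by
  have h := (Real.continuous_sqrt.tendsto 0).comp (tendsto_log_natCast_pow_div 3)
  rw [Real.sqrt_zero] at h
  refine h.congr fun T => ?_
  simp only [Function.comp]
  rw [Real.sqrt_div' _ (Nat.cast_nonneg T)]
  congr 1
  have hl : 0 ≤ Real.log T := Real.log_natCast_nonneg T
  rw [Real.sqrt_eq_iff_mul_self_eq (by positivity) (by positivity)]
  calc Real.log T ^ 3 = (√(Real.log T) ^ 2) ^ 3 := by rw [Real.sq_sqrt hl]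
    _ = _ := by ring

/-- The logarithmic factor of the lower bound is asymptotically half of `log T`. -/
theorem tendsto_log_mul_sqrt_div_log {κ : ℝ} (hκ : 0 < κ) :
    Tendsto (fun T : ℕ => Real.log (κ * √T / Real.log T) / Real.log T) atTop (𝓝 (1 / 2)) := by
  have hl := tendsto_log_natCast_atTop
  have h1 : Tendsto (fun T : ℕ => Real.log κ / Real.log T) atTop (𝓝 0) :=
    hl.const_div_atTop _
  have h2 : Tendsto (fun T : ℕ => Real.log (Real.log T) / Real.log T) atTop (𝓝 0) :=
    (Real.isLittleO_log_id_atTop.tendsto_div_nhds_zero).comp hl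
  have h := (h1.add_const (1 / 2)).sub h2
  rw [zero_add, sub_zero] at h
  refine h.congr' ?_
  filter_upwards [hl.eventually_gt_atTop 0, eventually_gt_atTop 0] with T hlT hT
  have hT' : (0 : ℝ) < T := by exact_mod_cast hT
  have hs : √(T : ℝ) ≠ 0 := (Real.sqrt_pos.2 hT').ne'
  rw [Real.log_div (by positivity) hlT.ne', Real.log_mul hκ.ne' hs, Real.log_sqrt hT'.le]
  field_simp

/-- The second limit shows that rounding `T / 2` down is harmless even when multiplied by the
squared radius, which is of order `log T`. -/
theorem tendsto_natCast_div_half : Tendsto (fun T : ℕ => (T : ℝ) / (T / 2 : ℕ)) atTop (𝓝 2) ∧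
    Tendsto (fun T : ℕ => ((T : ℝ) / (T / 2 : ℕ) - 2) * Real.log T) atTop (𝓝 0) := by
  have key : ∀ᶠ T : ℕ in atTop, 0 ≤ (T : ℝ) / (T / 2 : ℕ) - 2 ∧
      (T : ℝ) / (T / 2 : ℕ) - 2 ≤ 3 / T := by
    filter_upwards [eventually_ge_atTop 2] with T hT
    have hn : (0 : ℝ) < (T / 2 : ℕ) := by exact_mod_cast (by omega : 0 < T / 2)
    have hT' : (0 : ℝ) < T := by exact_mod_cast (by omega : 0 < T)
    have h1 : (2 : ℝ) * (T / 2 : ℕ) ≤ T := by exact_mod_cast (by omega : 2 * (T / 2) ≤ T)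
    have h2 : (T : ℝ) ≤ 2 * (T / 2 : ℕ) + 1 := by exact_mod_cast (by omega : T ≤ 2 * (T / 2) + 1)
    have h3 : (T : ℝ) ≤ 3 * (T / 2 : ℕ) := by exact_mod_cast (by omega : T ≤ 3 * (T / 2))
    constructor
    · rw [sub_nonneg, le_div_iff₀ hn]; exact h1
    · rw [sub_le_iff_le_add, div_le_iff₀ hn]
      have : (1 : ℝ) ≤ 3 / T * (T / 2 : ℕ) := by
        rw [div_mul_eq_mul_div, le_div_iff₀ hT']; linarith
      nlinarith
  have hz : Tendsto (fun T : ℕ => (3 : ℝ) / T) atTop (𝓝 0) := tendsto_const_div_atTop_nhds_zero_nat 3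
  have hz' : Tendsto (fun T : ℕ => (3 : ℝ) / T * Real.log T) atTop (𝓝 0) := by
    have h := (tendsto_log_natCast_pow_div 1).const_mul 3
    rw [mul_zero] at h
    exact h.congr fun T => by ring
  constructor
  · have h : Tendsto (fun T : ℕ => (T : ℝ) / (T / 2 : ℕ) - 2) atTop (𝓝 0) :=
      tendsto_of_tendsto_of_tendsto_of_le_of_le' tendsto_const_nhds hz
        (key.mono fun T h => h.1) (key.mono fun T h => h.2)
    simpa using h.add_const 2
  · refine tendsto_of_tendsto_of_tendsto_of_le_of_le' tendsto_const_nhds hz'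
      (key.mono fun T h => mul_nonneg h.1 (Real.log_natCast_nonneg T))
      (key.mono fun T h => mul_le_mul_of_nonneg_right h.2 (Real.log_natCast_nonneg T))

/-- The radius, in units of `√T`, of the window in which the random walk is estimated. -/
noncomputable def windowRadius (η κ : ℝ) (T : ℕ) : ℝ :=
  (1 - η * (Real.log T)⁻¹) * √(Real.log (κ * √T / Real.log T) / 2) + 1 / √T + 1 / √(Real.log T)

theorem tendsto_sqrt_half_log_div {κ : ℝ} (hκ : 0 < κ) :
    Tendsto (fun T : ℕ => √(Real.log (κ * √T / Real.log T) / 2) / √(Real.log T)) atTop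
      (𝓝 (1 / 2)) := by
  have h := (Real.continuous_sqrt.tendsto _).comp ((tendsto_log_mul_sqrt_div_log hκ).div_const 2)
  have h4 : √((1 / 2 : ℝ) / 2) = 1 / 2 := by
    rw [Real.sqrt_eq_iff_mul_self_eq (by norm_num) (by norm_num)]; norm_num
  rw [h4] at h
  refine h.congr fun T => ?_
  simp only [Function.comp]
  rw [← Real.sqrt_div' _ (Real.log_natCast_nonneg T)]
  congr 1
  ring

theorem tendsto_one_sub_mul_inv_log (η : ℝ) :
    Tendsto (fun T : ℕ => 1 - η * (Real.log T)⁻¹) atTop (𝓝 1) := by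
  simpa using (tendsto_log_natCast_atTop.inv_tendsto_atTop.const_mul η).const_sub 1

theorem tendsto_windowRadius_div_sqrt_log (η : ℝ) {κ : ℝ} (hκ : 0 < κ) :
    Tendsto (fun T : ℕ => windowRadius η κ T / √(Real.log T)) atTop (𝓝 (1 / 2)) := by
  have hl := tendsto_log_natCast_atTop
  have hs : Tendsto (fun T : ℕ => √(Real.log T)) atTop atTop := Real.tendsto_sqrt_atTop.comp hl
  have hT : Tendsto (fun T : ℕ => √(T : ℝ)) atTop atTop :=
    Real.tendsto_sqrt_atTop.comp tendsto_natCast_atTop_atTop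
  have h := (((tendsto_one_sub_mul_inv_log η).mul (tendsto_sqrt_half_log_div hκ)).add
    (hT.inv_tendsto_atTop.mul hs.inv_tendsto_atTop)).add
    (hs.inv_tendsto_atTop.mul hs.inv_tendsto_atTop)
  have hlim : 1 * (1 / 2 : ℝ) + 0 * 0 + 0 * 0 = 1 / 2 := by norm_num
  rw [hlim] at h
  refine h.congr fun T => ?_
  simp only [windowRadius, Pi.inv_apply]
  ring

/-- The shrinking factor `1 - η / log T` contributes `-η`, since the inner logarithm is about `(log
T) / 2`. The cross term with the window length `1 / √(log T)` contributes `2`; the rest vanishes. -/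
theorem tendsto_two_mul_windowRadius_sq_sub (η : ℝ) {κ : ℝ} (hκ : 0 < κ) :
    Tendsto (fun T : ℕ => 2 * windowRadius η κ T ^ 2 - Real.log (κ * √T / Real.log T)) atTop
      (𝓝 (2 - η)) := by
  have hl := tendsto_log_natCast_atTop
  have hs : Tendsto (fun T : ℕ => √(Real.log T)) atTop atTop := Real.tendsto_sqrt_atTop.comp hl
  have hT : Tendsto (fun T : ℕ => √(T : ℝ)) atTop atTop :=
    Real.tendsto_sqrt_atTop.comp tendsto_natCast_atTop_atTop
  have hP := tendsto_sqrt_half_log_div hκ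
  have h1 := ((hP.pow 2).const_mul 2).mul
    ((hl.inv_tendsto_atTop.const_mul (η ^ 2)).sub_const (2 * η))
  have h2 := (((tendsto_one_sub_mul_inv_log η).mul hP).const_mul 4).mul
    (tendsto_sqrt_log_natCast_div_sqrt.add_const 1)
  have h3 := ((hT.inv_tendsto_atTop.add hs.inv_tendsto_atTop).pow 2).const_mul 2
  have h := (h1.add h2).add h3
  have hlim : 2 * (1 / 2 : ℝ) ^ 2 * (η ^ 2 * 0 - 2 * η) + 4 * (1 * (1 / 2)) * (0 + 1) +
      2 * (0 + 0) ^ 2 = 2 - η := by ring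
  rw [hlim] at h
  refine h.congr' ?_
  have hLpos : ∀ᶠ T : ℕ in atTop, 0 < Real.log (κ * √T / Real.log T) / Real.log T :=
    (tendsto_log_mul_sqrt_div_log hκ).eventually_const_lt (by norm_num)
  filter_upwards [hLpos, hl.eventually_gt_atTop 0, eventually_gt_atTop 0] with T hLT hlT hT0
  have hT0' : (0 : ℝ) < T := by exact_mod_cast hT0
  simp only [windowRadius, Pi.inv_apply]
  set L := Real.log (κ * √T / Real.log T)
  have hL : 0 ≤ L / 2 := by
    have := (div_pos_iff_of_pos_right hlT).1 hLT
    positivity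
  set p := √(L / 2) with hp
  have hpp : L = 2 * p ^ 2 := by rw [hp, Real.sq_sqrt hL]; ring
  rw [hpp]
  set r := √(Real.log T) with hr
  have hrr : Real.log T = r ^ 2 := by rw [hr, Real.sq_sqrt hlT.le]
  have hr0 : 0 < r := Real.sqrt_pos.2 hlT
  have hs0 : 0 < √(T : ℝ) := Real.sqrt_pos.2 hT0'
  rw [hrr]
  field_simp
  ring

/-- The exponent of the moderate-deviation bound at the edge of the window. -/
theorem tendsto_exponent_sub (η : ℝ) {κ : ℝ} (hκ : 0 < κ) :
    Tendsto (fun T : ℕ => (T : ℝ) / (T / 2 : ℕ) * windowRadius η κ T ^ 2 +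
      4 * ((T : ℝ) / (T / 2 : ℕ)) ^ 2 * (windowRadius η κ T ^ 3 / √T) -
        Real.log (κ * √T / Real.log T)) atTop (𝓝 (2 - η)) := by
  have hl := tendsto_log_natCast_atTop
  have hq := tendsto_windowRadius_div_sqrt_log η hκ
  obtain ⟨hn, hnl⟩ := tendsto_natCast_div_half
  -- Replacing `T / n` by `2` costs `o(1)`, and the cubic term is of order `(log T) ^ (3 / 2) / √T`.
  have h := ((hnl.mul (hq.pow 2)).add (((hn.pow 2).const_mul 4).mul
    ((hq.pow 3).mul tendsto_sqrt_log_natCast_pow_three_div_sqrt))).add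
    (tendsto_two_mul_windowRadius_sq_sub η hκ)
  simp only [zero_mul, mul_zero, zero_add] at h
  refine h.congr' ?_
  filter_upwards [hl.eventually_gt_atTop 0] with T hlT
  set r := √(Real.log T) with hr
  have hrr : Real.log T = r ^ 2 := by rw [hr, Real.sq_sqrt hlT.le]
  have hr0 : 0 < r := Real.sqrt_pos.2 hlT
  set L := Real.log (κ * √T / Real.log T)
  rw [hrr]
  generalize (T : ℝ) / (T / 2 : ℕ) = ρ
  field_simp
  ring

theorem tendsto_windowRadius_div_sqrt (η : ℝ) {κ : ℝ} (hκ : 0 < κ) :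
    Tendsto (fun T : ℕ => windowRadius η κ T / √T) atTop (𝓝 0) := by
  have h := (tendsto_windowRadius_div_sqrt_log η hκ).mul tendsto_sqrt_log_natCast_div_sqrt
  rw [mul_zero] at h
  refine h.congr' ?_
  filter_upwards [tendsto_log_natCast_atTop.eventually_gt_atTop 0] with T hlT
  have hr0 : 0 < √(Real.log T) := Real.sqrt_pos.2 hlT
  field_simp

/-- The expected excess of the random walk eventually beats the guaranteed regret. -/
theorem eventually_lt_excess {C η U : ℝ} (hC : 0 < C) (hη0 : 0 < η) (hU : 0 < U) :
    ∀ᶠ T : ℕ in atTop, C * √(Real.exp 1) <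
      √2 * U / (η * U / (2 * √(Real.pi * Real.exp 1) * C)) * (1 - √(Real.log T) / √T) ^ 2 *
        Real.exp (-((T : ℝ) / (T / 2 : ℕ) *
            windowRadius η (η * U / (2 * √(Real.pi * Real.exp 1) * C)) T ^ 2 +
          4 * ((T : ℝ) / (T / 2 : ℕ)) ^ 2 *
            (windowRadius η (η * U / (2 * √(Real.pi * Real.exp 1) * C)) T ^ 3 / √T) -
          Real.log (η * U / (2 * √(Real.pi * Real.exp 1) * C) * √T / Real.log T))) := by
  have hpe : 0 < √(Real.pi * Real.exp 1) := Real.sqrt_pos.2 (by positivity)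
  have hκ : 0 < η * U / (2 * √(Real.pi * Real.exp 1) * C) := by positivity
  have h := (((tendsto_sqrt_log_natCast_div_sqrt.const_sub 1).pow 2).const_mul
    (√2 * U / (η * U / (2 * √(Real.pi * Real.exp 1) * C)))).mul
    ((Real.continuous_exp.tendsto _).comp (tendsto_exponent_sub η hκ).neg)
  refine h.eventually_const_lt ?_
  -- The limit is `C √e` times `(2 √(2π) / e) * (exp (η - 1) / η)`: the first factor exceeds `1`,
  -- the second is at least `1`.
  have hexp : η ≤ Real.exp (η - 1) := by linarith [Real.add_one_le_exp (η - 1)]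
  have hexp2 : Real.exp (-(2 - η)) = Real.exp (η - 1) / Real.exp 1 := by
    rw [← Real.exp_sub]; congr 1; ring
  have he : 0 < √(Real.exp 1) := Real.sqrt_pos.2 (Real.exp_pos 1)
  have hpi : Real.exp 1 < 2 * √2 * √Real.pi := by
    rw [mul_assoc, ← Real.sqrt_mul (by norm_num)]
    have h1 : (2.25 : ℝ) ≤ √(2 * Real.pi) :=
      Real.le_sqrt_of_sq_le (by nlinarith [Real.pi_gt_three])
    linarith [Real.exp_one_lt_d9]
  rw [hexp2, Real.sqrt_mul Real.pi_pos.le]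
  have hrew : √2 * U / (η * U / (2 * (√Real.pi * √(Real.exp 1)) * C)) * (1 - 0) ^ 2 *
      (Real.exp (η - 1) / Real.exp 1) =
      C * √(Real.exp 1) * ((2 * √2 * √Real.pi / Real.exp 1) * (Real.exp (η - 1) / η)) := by
    field_simp
    ring
  rw [hrew]
  refine lt_mul_of_one_lt_right (by positivity) ?_
  refine one_lt_mul_of_lt_of_le ?_ ?_
  · rwa [one_lt_div (Real.exp_pos 1)]
  · rwa [one_le_div hη0]

/-! ### Choice of parameters and conclusion. -/

theorem mainTheorem8 (C η U : ℝ) (hC : 0 < C) (hη : η ∈ Set.Ioo (0 : ℝ) 1)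
    (hU : 12 * η⁻¹ * C ≤ U) :
    ∃ T₀ : ℕ, 0 < T₀ ∧
      ∀ d : ℕ, 0 < d → ∀ T : ℕ, T₀ ≤ T → ∀ A : OLO.Algorithm d,
        (∀ adv : OLO.Adversary d, OLO.regret A adv T 0 ≤ C * √(Real.exp 1)) →
        ∃ (adv : OLO.Adversary d) (u : OLO.Point d), ‖u‖ = U ∧
          OLO.regret A adv T u ≥
            (1 - η * (Real.log T)⁻¹) * ‖u‖ *
              √(2 * T * Real.log
                (η * ‖u‖ * √(T : ℝ) / (2 * √(Real.pi * Real.exp 1) * C * Real.log T))) := by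
  obtain ⟨hη0, -⟩ := hη
  have hU0 : 0 < U := lt_of_lt_of_le (by positivity) hU
  have hexc := eventually_lt_excess hC hη0 hU0
  obtain ⟨κ, hκdef⟩ : ∃ κ, κ = η * U / (2 * √(Real.pi * Real.exp 1) * C) := ⟨_, rfl⟩
  have hpe : 0 < √(Real.pi * Real.exp 1) := Real.sqrt_pos.2 (by positivity)
  have hκ : 0 < κ := by rw [hκdef]; positivity
  rw [← hκdef] at hexc
  have hl := tendsto_log_natCast_atTop
  have hw : ∀ᶠ T : ℕ in atTop, 0 < 1 - η * (Real.log T)⁻¹ :=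
    (tendsto_one_sub_mul_inv_log η).eventually_const_lt (by norm_num)
  -- With `T ≤ 3 * n`, the bound `1 / 12` puts the window edge within `n / 4`, as the binomial
  -- estimate requires.
  have hq : ∀ᶠ T : ℕ in atTop, windowRadius η κ T / √T < 1 / 12 :=
    (tendsto_windowRadius_div_sqrt η hκ).eventually_lt_const (by norm_num)
  have hr : ∀ᶠ T : ℕ in atTop, √(Real.log T) / √T < 1 :=
    tendsto_sqrt_log_natCast_div_sqrt.eventually_lt_const (by norm_num)
  obtain ⟨T₀, hT₀⟩ := eventually_atTop.1
    (hexc.and (hw.and (hq.and (hr.and (hl.eventually_gt_atTop 0)))))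
  refine ⟨max T₀ 2, by positivity, fun d hd T hT A hA => ?_⟩
  obtain ⟨hexc, hw, hq, hr, hl⟩ := hT₀ T (le_trans (le_max_left _ _) hT)
  have hT2 : 2 ≤ T := le_trans (le_max_right _ _) hT
  clear hT₀
  -- The walk has `2 * n` steps, so that it has a central coefficient; for odd `T` the last gradient
  -- is `0`.
  obtain ⟨n, hn⟩ : ∃ n, n = T / 2 := ⟨_, rfl⟩
  rw [← hn] at hexc
  have hn1 : 1 ≤ n := by omega
  have hn0 : (0 : ℝ) < n := by exact_mod_cast hn1
  have hT0 : (0 : ℝ) < T := by exact_mod_cast (by omega : 0 < T)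
  have hnT : 2 * (n : ℝ) ≤ T := by exact_mod_cast (by omega : 2 * n ≤ T)
  have hTn : (T : ℝ) ≤ 3 * n := by exact_mod_cast (by omega : T ≤ 3 * n)
  have hs0 : 0 < √(T : ℝ) := Real.sqrt_pos.2 hT0
  have hss : √(T : ℝ) * √T = T := Real.mul_self_sqrt hT0.le
  have hr0 : 0 < √(Real.log T) := Real.sqrt_pos.2 hl
  have hrr : √(Real.log T) * √(Real.log T) = Real.log T := Real.mul_self_sqrt hl.le
  set L := Real.log (κ * √T / Real.log T) with hL
  set q := windowRadius η κ T with hqdef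
  set a := (1 - η * (Real.log T)⁻¹) * √(2 * T * L) with ha
  have ha0 : 0 ≤ a := by positivity
  have ha2 : a / 2 = √T * ((1 - η * (Real.log T)⁻¹) * √(L / 2)) := by
    have h4 : √(2 * T * L) = 2 * (√T * √(L / 2)) := by
      rw [show 2 * (T : ℝ) * L = 2 ^ 2 * (T * (L / 2)) by ring, Real.sqrt_mul (by norm_num),
        Real.sqrt_sq (by norm_num), Real.sqrt_mul hT0.le]
    rw [ha, h4]; ring
  obtain ⟨K, hK⟩ : ∃ K, K = ⌈a / 2⌉₊ := ⟨_, rfl⟩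
  obtain ⟨N, hN⟩ : ∃ N, N = ⌊√T / √(Real.log T)⌋₊ := ⟨_, rfl⟩
  have hKge : a ≤ 2 * (K : ℝ) := by
    have := Nat.le_ceil (a / 2)
    rw [← hK] at this; linarith
  have hKle : (K : ℝ) ≤ a / 2 + 1 := by
    rw [hK]; exact (Nat.ceil_lt_add_one (by positivity)).le
  have hNle : (N : ℝ) ≤ √T / √(Real.log T) := by rw [hN]; exact Nat.floor_le (by positivity)
  have hNge : √T / √(Real.log T) * (1 - √(Real.log T) / √T) ≤ N := by
    have h1 : √T / √(Real.log T) * (1 - √(Real.log T) / √T) = √T / √(Real.log T) - 1 := by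
      field_simp
    rw [h1, hN]; exact (Nat.sub_one_lt_floor _).le
  -- The three terms of `windowRadius` are the threshold `a / 2`, the rounding error of `K`, and the
  -- window length.
  have hMq : ((K + N : ℕ) : ℝ) ≤ √T * q := by
    have : √T * q = a / 2 + 1 + √T / √(Real.log T) := by
      rw [ha2, hqdef, windowRadius, ← hL]; field_simp
    rw [this]; push_cast; linarith
  have hM4 : 4 * (K + N) ≤ n := by
    have h1 : √T * q ≤ n / 4 := by
      have h2 : q ≤ 1 / 12 * √T := by rw [div_lt_iff₀ hs0] at hq; exact hq.le
      nlinarith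
    have : 4 * ((K + N : ℕ) : ℝ) ≤ n := by linarith
    exact_mod_cast this
  have hEB : ((K + N : ℕ) : ℝ) ^ 2 / n + 4 * ((K + N : ℕ) : ℝ) ^ 3 / (n : ℝ) ^ 2 ≤
      (T : ℝ) / n * q ^ 2 + 4 * ((T : ℝ) / n) ^ 2 * (q ^ 3 / √T) := by
    have h1 : (T : ℝ) / n * q ^ 2 + 4 * ((T : ℝ) / n) ^ 2 * (q ^ 3 / √T) =
        (√T * q) ^ 2 / n + 4 * (√T * q) ^ 3 / (n : ℝ) ^ 2 := by
      have h2 : (T : ℝ) = √T ^ 2 := by rw [pow_two, hss]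
      generalize √(T : ℝ) = s at *
      rw [h2]
      field_simp
    rw [h1]
    gcongr
  set B := (T : ℝ) / n * q ^ 2 + 4 * ((T : ℝ) / n) ^ 2 * (q ^ 3 / √T) with hB
  have hchoose : (4 : ℝ) ^ n * Real.exp (-B) ≤
      2 * √n * (2 * n).choose (n + (K + N)) := by
    calc (4 : ℝ) ^ n * Real.exp (-B)
        ≤ (2 * √n * n.centralBinom) * Real.exp (-(((K + N : ℕ) : ℝ) ^ 2 / n +
            4 * ((K + N : ℕ) : ℝ) ^ 3 / (n : ℝ) ^ 2)) := by
          gcongr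
          exact four_pow_le_two_sqrt_mul_centralBinom hn1
      _ ≤ _ := by
          rw [mul_assoc]
          exact mul_le_mul_of_nonneg_left (centralBinom_mul_exp_le_choose hn1 _ hM4)
            (by positivity)
  -- Since `exp L = κ √T / log T`, the factors of `T` and `log T` cancel against `N ^ 2 ≈ T / log T`
  -- and `√n`.
  have hvalue : √2 * U / κ * (1 - √(Real.log T) / √T) ^ 2 * Real.exp (-(B - L)) * √n ≤
      U * (N : ℝ) ^ 2 * Real.exp (-B) := by
    have hexpL : Real.exp L = κ * √T / Real.log T := Real.exp_log (by positivity)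
    have hsn : √2 * √n ≤ √T := by
      rw [← Real.sqrt_mul (by norm_num)]; exact Real.sqrt_le_sqrt hnT
    rw [neg_sub, sub_eq_add_neg L B, Real.exp_add, hexpL]
    calc √2 * U / κ * (1 - √(Real.log T) / √T) ^ 2 *
          (κ * √T / Real.log T * Real.exp (-B)) * √n
        = (√2 * √n) * (√T * (U / Real.log T * (1 - √(Real.log T) / √T) ^ 2 * Real.exp (-B))) := by
          field_simp
      _ ≤ √T * (√T * (U / Real.log T * (1 - √(Real.log T) / √T) ^ 2 * Real.exp (-B))) := by
          gcongr
      _ = U * (√T / √(Real.log T) * (1 - √(Real.log T) / √T)) ^ 2 * Real.exp (-B) := by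
          rw [mul_pow, div_pow, pow_two √(Real.log T), hrr]; ring
      _ ≤ _ := by
          have : 0 ≤ 1 - √(Real.log T) / √T := by linarith
          gcongr
  have hwin := two_mul_sq_mul_choose_le_sum (n := n) (K := K) (N := N) (by omega) hU0.le
    (R := U * a) (by gcongr)
  have hsn0 : 0 < √(n : ℝ) := Real.sqrt_pos.2 hn0
  obtain ⟨adv, u, hu, hreg⟩ := OLO.exists_regret_ge hd A (m := 2 * n) (T := T) (by omega)
    (U := U) (R := U * a) (ε := C * √(Real.exp 1)) hU0.le (by positivity) hA (by
      push_cast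
      refine lt_of_lt_of_le ?_ hwin
      refine lt_of_mul_lt_mul_right ?_ hsn0.le
      calc 2 ^ (2 * n) * (C * √(Real.exp 1)) * √n = 4 ^ n * (C * √(Real.exp 1) * √n) := by
            rw [pow_mul]; norm_num; ring
        _ < 4 ^ n * (√2 * U / κ * (1 - √(Real.log T) / √T) ^ 2 * Real.exp (-(B - L)) * √n) := by
            gcongr
        _ ≤ 4 ^ n * (U * (N : ℝ) ^ 2 * Real.exp (-B)) := by gcongr
        _ = U * (N : ℝ) ^ 2 * (4 ^ n * Real.exp (-B)) := by ring
        _ ≤ U * (N : ℝ) ^ 2 * (2 * √n * (2 * n).choose (n + (K + N))) := by gcongr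
        _ = _ := by ring)
  refine ⟨adv, u, hu, ?_⟩
  have harg : η * U * √(T : ℝ) / (2 * √(Real.pi * Real.exp 1) * C * Real.log T) =
      κ * √T / Real.log T := by
    rw [hκdef]; field_simp
  rw [hu, harg, ge_iff_le]
  refine le_trans (le_of_eq ?_) hreg
  rw [ha]; ring
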